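/- For a finite simple graph $G$ let $\mathcal{D}_q^G$ be its exponential distance matrix: its $(u,v)$ entry is $q^{\operatorname{dist}_G(u,v)}$ if $u$ and $v$ lie in the same component of $G$, and $0$ otherwise. Two graphs are $\mathcal{D}_q$-cospectral if their exponential distance matrices have the same characteristic polynomial (equivalently, the same spectrum with multiplicities). "Attaching a path with $m$ vertices at $a$" means adding $m$ new vertices $v_1,\dots,v_m$ and the edges $a v_1, v_1v_2,\dots,v_{m-1}v_m$. Let $k\ge 0$ be an integer, and let $C$ be a 4-cycle with vertices $c_0,c_1,c_2,c_3$ in cyclic order. Let $G_1$ be obtained from $C$ by attaching a path with $1$ vertex at $c_0$, a path with $k+3$ vertices and a path with $k+2$ vertices at $c_1$, and a path with $k+1$ vertices at $c_2$. Let $G_2$ be obtained from $C$ by attaching a path with $2$ vertices and a path with $k+2$ vertices at $c_0$, a path with $k+2$ vertices at $c_1$, and a path with $k+1$ vertices at $c_2$. Then, for every $k\ge 0$, $G_1$ and $G_2$ are $\mathcal{D}_q$-cospectral: the characteristic polynomials of $\mathcal{D}_q^{G_1}$ and $\mathcal{D}_q^{G_2}$ are equal for $q$ an indeterminate and for $q$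 any element of any commutative ring; in particular, for every complex number $q$, $\mathcal{D}_q^{G_1}$ and $\mathcal{D}_q^{G_2}$ have the same multiset of eigenvalues. -/

import Mathlib

open Classical in
/-- The exponential distance matrix `D_q` of a graph `G`: the `(u, v)` entry is `q ^ dist(u, v)` if
`u` and `v` lie in the same component, and `0` otherwise. The parameter `q` may be any element of
any commutative ring, so it can be a number or an indeterminate. -/
noncomputable def expDistMatrix {R : Type*} [CommRing R] (q : R) {V : Type*}
    (G : SimpleGraph V) : Matrix V V R :=
  Matrix.of fun u v => if G.Reachable u v then q ^ G.dist u v else 0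

/-- `G` and `H` are `D_q`-cospectral: their exponential distance matrices have the same
characteristic polynomial `det (x I - D_q)`, i.e. the same eigenvalues with multiplicity. -/
def DqCospectral {R : Type*} [CommRing R] (q : R) {V W : Type*} [Fintype V] [DecidableEq V]
    [Fintype W] [DecidableEq W] (G : SimpleGraph V) (H : SimpleGraph W) : Prop :=
  (expDistMatrix q G).charpoly = (expDistMatrix q H).charpoly

/-- The spectrum of `D_q` for a complex number `q`: the multiset of its complex eigenvalues,
counted with algebraic multiplicity. -/
noncomputable def expDistSpectrum (q : ℂ) {V : Type*} [Fintype V] [DecidableEq V]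
    (G : SimpleGraph V) : Multiset ℂ :=
  (expDistMatrix q G).charpoly.roots

/-- The adjacency relation of `attachPaths`. -/
def attachPathsAdj {V ι : Type*} (C : SimpleGraph V) (r : ι → V) (l : ι → ℕ) :
    V ⊕ (Σ i : ι, Fin (l i)) → V ⊕ (Σ i : ι, Fin (l i)) → Prop
  | .inl u, .inl v => C.Adj u v
  | .inl u, .inr p => u = r p.1 ∧ (p.2 : ℕ) = 0
  | .inr p, .inl u => u = r p.1 ∧ (p.2 : ℕ) = 0
  | .inr p, .inr p' => p.1 = p'.1 ∧ ((p.2 : ℕ) + 1 = p'.2 ∨ (p'.2 : ℕ) + 1 = p.2)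

/-- The graph obtained from `C` by attaching, for every index `i`, a pendant path at the vertex
`r i`, where the path has `l i` new vertices `⟨i, 0⟩, ⟨i, 1⟩, …, ⟨i, l i - 1⟩` (in this order along
the path) and `⟨i, 0⟩` is joined to `r i`. -/
def attachPaths {V ι : Type*} (C : SimpleGraph V) (r : ι → V) (l : ι → ℕ) :
    SimpleGraph (V ⊕ (Σ i : ι, Fin (l i))) where
  Adj := attachPathsAdj C r l
  symm := ⟨by
    rintro (u | p) (v | p') h
    · exact SimpleGraph.Adj.symm (G := C) h
    · exact h
    · exact h
    · exact ⟨h.1.symm, h.2.symm⟩⟩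
  loopless := ⟨by
    rintro (u | p) h
    · exact SimpleGraph.irrefl C h
    · rcases h.2 with h | h <;> omega⟩

/-- The graph `G₁` with parameter `k`: the 4-cycle on `0, 1, 2, 3` (in cyclic order) with a pendant
path of `1` vertex at `0`, pendant paths of `k + 3` and of `k + 2` vertices at `1`, and a pendant
path of `k + 1` vertices at `2`. -/
def familyG₁ (k : ℕ) : SimpleGraph (Fin 4 ⊕ (Σ i : Fin 4, Fin (![1, k + 3, k + 2, k + 1] i))) :=
  attachPaths (SimpleGraph.cycleGraph 4) ![0, 1, 1, 2] ![1, k + 3, k + 2, k + 1]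

/-- The graph `G₂` with parameter `k`: the 4-cycle on `0, 1, 2, 3` (in cyclic order) with pendant
paths of `2` and of `k + 2` vertices at `0`, a pendant path of `k + 2` vertices at `1`, and a
pendant path of `k + 1` vertices at `2`. -/
def familyG₂ (k : ℕ) : SimpleGraph (Fin 4 ⊕ (Σ i : Fin 4, Fin (![2, k + 2, k + 2, k + 1] i))) :=
  attachPaths (SimpleGraph.cycleGraph 4) ![0, 0, 1, 2] ![2, k + 2, k + 2, k + 1]

/-!
Let `D` be the exponential distance matrix of a connected graph `C`, and attach paths of lengths
`l i` at the vertices `r i`. A vertex at position `j = 0, 1, …` of a path has distance `j + 1` to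
its root, so the matrix of the large graph is `W D Wᵀ` plus a block diagonal correction. Row `u` of
`W` has its only nonzero entry in the column of the root of `u`: the power of `q` to the distance
from `u` to that root (a vertex of `C` is its own root). The correction is `0` on `C`, and on a path of
length `l` it is the matrix `B` with entries `q ^ |j - k| - w j * w k`,
with `w = (q, q², …, q ^ l)`.

Hence `x I - D_q` is `A - W D Wᵀ` with `A` block diagonal, and the matrix determinant lemma reduces
its determinant to size `V × V` (`det_sub_expDistMatrix_attachPaths`):
`x ^ |V| * ∏ i, β (l i) * det (1 - diag g * D)` with `g v = 1 / x + ∑ τ (l i) / β (l i)`, the sum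
running over the paths attached at `v`. Here `β l = det (x I - B)` and
`τ l / β l = wᵀ (x I - B)⁻¹ w`. Removing the first vertex of a path gives a linear recursion of
first order for the pair `(β, τ)` (`pathSeq`, `det_pathMatrix_sub`).

For the two families, the recursion expresses both determinants through `x`, `q` and the pair
`(β, τ)` at `k + 1`, and they agree as rational functions of these four quantities
(`family_det_identity`). The divisions take place in the fraction field of `ℤ[q][x]`. The
characteristic polynomials are therefore equal for the indeterminate `q` over `ℤ`, and the
specializations `ℤ[q] → R` carry this to every commutative ring.
-/

/-! ### Distances in a graph with attached paths -/

/-- A function `d` which vanishes on the diagonal, grows by at most `1` along every edge and can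
always be decreased by `1` by moving to a neighbour is the distance of a connected graph. -/
theorem SimpleGraph.reachable_and_dist_eq {V : Type*} {G : SimpleGraph V} (d : V → V → ℕ)
    (h0 : ∀ u, d u u = 0) (hL : ∀ u v w, G.Adj v w → d u w ≤ d u v + 1)
    (hdesc : ∀ u v, u ≠ v → ∃ w, G.Adj w v ∧ d u w + 1 = d u v) (u v : V) :
    G.Reachable u v ∧ G.dist u v = d u v := by
  have lower : ∀ {v w : V} (p : G.Walk v w), d u w ≤ d u v + p.length := by
    intro v w p
    induction p with
    | nil => simp
    | cons h p ih =>
      have := hL u _ _ h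
      rw [SimpleGraph.Walk.length_cons]
      omega
  have upper : ∀ (n : ℕ) (v : V), d u v = n → ∃ p : G.Walk u v, p.length = n := by
    intro n
    induction n with
    | zero =>
      intro v hv
      by_cases huv : u = v
      · subst huv
        exact ⟨.nil, rfl⟩
      · obtain ⟨w, -, hw⟩ := hdesc u v huv
        omega
    | succ n ih =>
      intro v hv
      have huv : u ≠ v := by
        rintro rfl
        simp [h0] at hv
      obtain ⟨w, hwv, hw⟩ := hdesc u v huv
      obtain ⟨p, hp⟩ := ih w (by omega)
      exact ⟨p.concat hwv, by simp [hp]⟩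
  obtain ⟨p, hp⟩ := upper _ v rfl
  obtain ⟨p', hp'⟩ := p.reachable.exists_walk_length_eq_dist
  have h1 := lower p'
  have h2 := SimpleGraph.dist_le p
  rw [h0] at h1
  exact ⟨p.reachable, by omega⟩

/-- The distance of `attachPaths C r l` for a connected graph `C`. The distance `|a - b|` of two
vertices of one path is written with truncated subtractions. -/
noncomputable def attachPathsDist {V ι : Type*} [DecidableEq ι] (C : SimpleGraph V) (r : ι → V)
    (l : ι → ℕ) :
    V ⊕ (Σ i : ι, Fin (l i)) → V ⊕ (Σ i : ι, Fin (l i)) → ℕ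
  | .inl u, .inl v => C.dist u v
  | .inl u, .inr p => C.dist u (r p.1) + (p.2 + 1)
  | .inr p, .inl u => (p.2 + 1) + C.dist (r p.1) u
  | .inr p, .inr p' =>
    if p.1 = p'.1 then ((p.2 : ℕ) - p'.2) + (p'.2 - p.2)
    else (p.2 + 1) + C.dist (r p.1) (r p'.1) + (p'.2 + 1)

theorem SimpleGraph.Connected.dist_le_dist_add_one {V : Type*} {C : SimpleGraph V}
    (hC : C.Connected) (u : V) {v w : V} (h : C.Adj v w) : C.dist u w ≤ C.dist u v + 1 := by
  have := hC.dist_triangle (u := u) (v := v) (w := w)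
  rwa [SimpleGraph.dist_eq_one_iff_adj.2 h] at this

theorem SimpleGraph.Connected.exists_adj_dist_add_one_eq {V : Type*} {C : SimpleGraph V}
    (hC : C.Connected) {u v : V} (h : u ≠ v) : ∃ w, C.Adj w v ∧ C.dist u w + 1 = C.dist u v := by
  obtain ⟨p, hp⟩ := hC.exists_walk_length_eq_dist v u
  cases p with
  | nil => exact absurd rfl h
  | cons hadj p =>
    rename_i w
    refine ⟨w, hadj.symm, ?_⟩
    have h1 := SimpleGraph.dist_le p
    have h2 := hC.dist_le_dist_add_one u hadj.symm
    rw [SimpleGraph.Walk.length_cons] at hp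
    rw [SimpleGraph.dist_comm (u := u) (v := w), SimpleGraph.dist_comm (u := u) (v := v)] at *
    omega

theorem attachPaths_reachable_and_dist {V ι : Type*} [DecidableEq ι] {C : SimpleGraph V}
    (hC : C.Connected) (r : ι → V) (l : ι → ℕ) (u v : V ⊕ (Σ i : ι, Fin (l i))) :
    (attachPaths C r l).Reachable u v ∧
      (attachPaths C r l).dist u v = attachPathsDist C r l u v := by
  refine SimpleGraph.reachable_and_dist_eq _ ?_ ?_ ?_ u v
  · rintro (u | p) <;> simp [attachPathsDist]
  · rintro (u | ⟨i, a⟩) (v | ⟨j, b⟩) (w | ⟨m, c⟩) h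
    · exact hC.dist_le_dist_add_one u h
    · obtain ⟨rfl, h⟩ : v = r m ∧ (c : ℕ) = 0 := h
      simp [attachPathsDist, h]
    · obtain ⟨rfl, h⟩ : w = r j ∧ (b : ℕ) = 0 := h
      simp only [attachPathsDist]
      omega
    · obtain ⟨h, h'⟩ : j = m ∧ ((b : ℕ) + 1 = c ∨ (c : ℕ) + 1 = b) := h
      subst h
      simp only [attachPathsDist]
      omega
    · have := hC.dist_le_dist_add_one (r i) h
      simp only [attachPathsDist]
      omega
    · obtain ⟨rfl, h⟩ : v = r m ∧ (c : ℕ) = 0 := h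
      simp only [attachPathsDist]
      split_ifs <;> omega
    · obtain ⟨rfl, h⟩ : w = r j ∧ (b : ℕ) = 0 := h
      simp only [attachPathsDist]
      split_ifs with hij
      · subst hij
        simp only [SimpleGraph.dist_self]
        omega
      · omega
    · obtain ⟨h, h'⟩ : j = m ∧ ((b : ℕ) + 1 = c ∨ (c : ℕ) + 1 = b) := h
      subst h
      simp only [attachPathsDist]
      split_ifs <;> omega
  · -- The neighbour of a path vertex that is closer to `u` is its predecessor on the path, unless
    -- `u` lies further out on the same path.
    have parent : ∀ (u : V ⊕ (Σ i : ι, Fin (l i))) (j : ι) (b : Fin (l j)),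
        (∀ a : Fin (l j), u = .inr ⟨j, a⟩ → (a : ℕ) < b) →
        ∃ w, (attachPaths C r l).Adj w (.inr ⟨j, b⟩) ∧
          attachPathsDist C r l u w + 1 = attachPathsDist C r l u (.inr ⟨j, b⟩) := by
      rintro u j ⟨b, hb⟩ hu
      cases b with
      | zero =>
        refine ⟨.inl (r j), ⟨rfl, rfl⟩, ?_⟩
        rcases u with u | ⟨i, a⟩
        · rfl
        · by_cases hij : i = j
          · subst hij
            exact absurd (hu a rfl) (by simp)
          · simp [attachPathsDist, hij]
      | succ b =>
        refine ⟨.inr ⟨j, ⟨b, by omega⟩⟩, ⟨rfl, .inl rfl⟩, ?_⟩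
        rcases u with u | ⟨i, a⟩
        · simp only [attachPathsDist]
          omega
        · by_cases hij : i = j
          · subst hij
            have : (a : ℕ) < b + 1 := hu a rfl
            simp only [attachPathsDist, if_true]
            omega
          · simp only [attachPathsDist, hij, if_false]
            omega
    rintro (u | ⟨i, a⟩) (v | ⟨j, b⟩) huv
    · obtain ⟨w, hw, hd⟩ := hC.exists_adj_dist_add_one_eq (u := u) (v := v) (by simpa using huv)
      exact ⟨.inl w, hw, hd⟩
    · exact parent _ j b (by simp)
    · by_cases hv : r i = v
      · refine ⟨.inr ⟨i, ⟨0, a.pos⟩⟩, ⟨hv.symm, rfl⟩, ?_⟩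
        simp [attachPathsDist, hv]
      · obtain ⟨w, hw, hd⟩ := hC.exists_adj_dist_add_one_eq hv
        refine ⟨.inl w, hw, ?_⟩
        simp only [attachPathsDist]
        omega
    · by_cases hij : i = j
      · subst hij
        rcases lt_trichotomy (a : ℕ) b with hab | hab | hab
        · refine parent _ i b fun a' ha' => ?_
          simp only [Sum.inr.injEq, Sigma.mk.injEq, heq_eq_eq, true_and] at ha'
          exact ha' ▸ hab
        · exact absurd (by rw [Fin.ext hab]) huv
        · refine ⟨.inr ⟨i, ⟨b + 1, by omega⟩⟩, ⟨rfl, .inr rfl⟩, ?_⟩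
          simp only [attachPathsDist, if_true]
          omega
      · refine parent _ j b fun a' ha' => ?_
        simp only [Sum.inr.injEq, Sigma.mk.injEq] at ha'
        exact absurd ha'.1 hij

theorem expDistMatrix_attachPaths {R V ι : Type*} [CommRing R] [DecidableEq ι] (q : R)
    {C : SimpleGraph V} (hC : C.Connected) (r : ι → V) (l : ι → ℕ)
    (u v : V ⊕ (Σ i : ι, Fin (l i))) :
    expDistMatrix q (attachPaths C r l) u v = q ^ attachPathsDist C r l u v := by
  obtain ⟨h, h'⟩ := attachPaths_reachable_and_dist hC r l u v
  simp [expDistMatrix, h, h']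

theorem expDistMatrix_of_connected {R V : Type*} [CommRing R] (q : R)
    {C : SimpleGraph V} (hC : C.Connected) (u v : V) :
    expDistMatrix q C u v = q ^ C.dist u v := by
  simp [expDistMatrix, hC u v]

theorem connected_cycleGraph_four : (SimpleGraph.cycleGraph 4).Connected :=
  SimpleGraph.cycleGraph_connected

theorem expDistMatrix_cycleGraph_four {R : Type*} [CommRing R] (q : R) :
    expDistMatrix q (SimpleGraph.cycleGraph 4) =
      !![1, q, q ^ 2, q; q, 1, q, q ^ 2; q ^ 2, q, 1, q; q, q ^ 2, q, 1] := by
  have h := SimpleGraph.reachable_and_dist_eq (G := SimpleGraph.cycleGraph 4)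
    !![0, 1, 2, 1; 1, 0, 1, 2; 2, 1, 0, 1; 1, 2, 1, 0] (by decide) (by decide) (by decide)
  ext i j
  rw [expDistMatrix, Matrix.of_apply, if_pos (h i j).1, (h i j).2]
  fin_cases i <;> fin_cases j <;> simp

/-! ### Determinants of perturbed and of block diagonal matrices -/

open Matrix in
/-- A form of the matrix determinant lemma that needs no invertibility, only a solution `Y` of
`A * Y = U`. -/
theorem Matrix.det_sub_mul_of_mul_eq {R m n : Type*} [CommRing R] [Fintype m] [DecidableEq m]
    [Fintype n] [DecidableEq n] {A : Matrix m m R} {Y U : Matrix m n R} (h : A * Y = U)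
    (V : Matrix n m R) : (A - U * V).det = A.det * (1 - V * Y).det := by
  rw [← Matrix.det_one_sub_mul_comm, ← Matrix.det_mul, Matrix.mul_sub, Matrix.mul_one,
    ← Matrix.mul_assoc, h]

open Matrix in
theorem Matrix.det_sub_vecMulVec_of_mulVec_eq {R m : Type*} [CommRing R] [Fintype m]
    [DecidableEq m] {A : Matrix m m R} {y u : m → R} (h : A *ᵥ y = u) (v : m → R) :
    (A - Matrix.vecMulVec u v).det = A.det * (1 - v ⬝ᵥ y) := by
  have h' : A * Matrix.replicateCol Unit y = Matrix.replicateCol Unit u := by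
    rw [← h, Matrix.replicateCol_mulVec]
  rw [Matrix.vecMulVec_eq Unit, Matrix.det_sub_mul_of_mul_eq h']
  simp [Matrix.det_unique, Matrix.mul_apply, dotProduct]

open Matrix in
/-- The value of `wᵀ A⁻¹ w` is determined by the determinants of `A` and `A - w wᵀ`. -/
theorem Matrix.exists_mulVec_eq_of_det_sub_vecMulVec {K m : Type*} [Field K] [Fintype m]
    [DecidableEq m] {A : Matrix m m K} {w : m → K} {β τ : K} (hβ : β ≠ 0) (h0 : A.det = β)
    (h1 : (A - Matrix.vecMulVec w w).det = β - τ) : ∃ y, A *ᵥ y = w ∧ w ⬝ᵥ y = τ / β := by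
  have hu : IsUnit A.det := h0 ▸ hβ.isUnit
  have hy : A *ᵥ (A⁻¹ *ᵥ w) = w := by
    rw [Matrix.mulVec_mulVec, Matrix.mul_nonsing_inv _ hu, Matrix.one_mulVec]
  refine ⟨_, hy, ?_⟩
  rw [Matrix.det_sub_vecMulVec_of_mulVec_eq hy, h0] at h1
  rw [eq_div_iff hβ]
  linear_combination -h1

theorem Matrix.det_blockDiagonal' {R ι : Type*} [CommRing R] [Fintype ι] [LinearOrder ι]
    {n : ι → Type*} [∀ i, Fintype (n i)] [∀ i, DecidableEq (n i)]
    (M : ∀ i, Matrix (n i) (n i) R) : (Matrix.blockDiagonal' M).det = ∏ i, (M i).det := by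
  rw [(Matrix.blockTriangular_blockDiagonal' M).det_fintype]
  refine Finset.prod_congr rfl fun i _ => ?_
  let e : n i ≃ {p : Σ j, n j // p.1 = i} := (Equiv.sigmaSubtype i).symm
  rw [← Matrix.det_submatrix_equiv_self e]
  congr 1
  ext a b
  exact Matrix.blockDiagonal'_apply_eq M i a b

/-! ### The contribution of one path -/

/-- The numbers `β l` and `τ l`, as a pair: `β l = det (x I - B)` and `τ l = wᵀ adj (x I - B) w`,
where `w = (q, q², …, q ^ l)` and `B j k = q ^ |j - k| - w j * w k` for `j, k < l`. -/
def pathSeq {R : Type*} [CommRing R] (x q : R) : ℕ → R × R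
  | 0 => (1, 0)
  | l + 1 =>
    ((x - (1 - q ^ 2)) * (pathSeq x q l).1 - (1 - q ^ 2) * x * (pathSeq x q l).2,
      q ^ 2 * ((pathSeq x q l).1 + x * (pathSeq x q l).2))

/-- The vector `(q, q², …, q ^ l)`: the powers of `q` to the distances from the root to the
vertices of an attached path. -/
def pathVec {R : Type*} [CommRing R] (q : R) (l : ℕ) : Fin l → R := fun j => q ^ ((j : ℕ) + 1)

/-- The matrix `x I - B` with `B j k = q ^ |j - k| - w j * w k`, where `w = pathVec q l`. The entry
`q ^ |j - k|` is that of `D_q` for two vertices of one attached path, and `w j * w k` is what it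
would be if the shortest path between them passed through the root. The distance `|j - k|` is
written with truncated subtractions. -/
def pathMatrix {R : Type*} [CommRing R] (x q : R) (l : ℕ) : Matrix (Fin l) (Fin l) R :=
  Matrix.of fun j k =>
    (if j = k then x else 0) -
      (q ^ (((j : ℕ) - k) + (k - j)) - q ^ ((j : ℕ) + 1) * q ^ ((k : ℕ) + 1))

open Matrix in
/-- The perturbation by `c w wᵀ` makes the induction work, and the case `c = 1` determines `wᵀ y`
for the solution `y` of `(x I - B) y = w`. The inductive step removes the first vertex of the path:
with `e = 1 - q² + c q²`, the matrix for `l + 1` is obtained from the direct sum of `x` and the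
unperturbed matrix of the shorter path by subtracting `e (1, w) (1, w)ᵀ`. -/
theorem det_pathMatrix_sub {K : Type*} [Field K] {x q : K} (hx : x ≠ 0)
    (hβ : ∀ l, (pathSeq x q l).1 ≠ 0) (l : ℕ) (c : K) :
    (pathMatrix x q l - Matrix.vecMulVec (c • pathVec q l) (pathVec q l)).det =
      (pathSeq x q l).1 - c * (pathSeq x q l).2 := by
  induction l generalizing c with
  | zero => simp [pathSeq]
  | succ l ih =>
    have hdet : (pathMatrix x q l).det = (pathSeq x q l).1 := by simpa using ih 0
    obtain ⟨y, hy, hwy⟩ := Matrix.exists_mulVec_eq_of_det_sub_vecMulVec (hβ l) hdet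
      (by simpa using ih 1)
    rw [eq_div_iff (hβ l)] at hwy
    set e : K := 1 - q ^ 2 + c * q ^ 2 with he
    -- The direct sum of the 1 × 1 matrix `x` and `pathMatrix x q l`.
    let A : Matrix (Fin (l + 1)) (Fin (l + 1)) K :=
      Matrix.of (Fin.cons (Fin.cons x 0) fun j => Fin.cons 0 (pathMatrix x q l j))
    have hA : A.det = x * (pathSeq x q l).1 := by
      rw [Matrix.det_succ_row_zero, Fin.sum_univ_succ]
      have : A.submatrix Fin.succ Fin.succ = pathMatrix x q l := by
        ext j k
        simp [A]
      simp [A, ← hdet, this]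
    have hAy : A *ᵥ (e • (Fin.cons x⁻¹ y : Fin (l + 1) → K)) =
        e • (Fin.cons 1 (pathVec q l) : Fin (l + 1) → K) := by
      rw [Matrix.mulVec_smul, ← hy]
      congr 1
      ext j
      refine Fin.cases ?_ (fun j => ?_) j
      · simp [A, Matrix.mulVec, dotProduct, Fin.sum_univ_succ, hx]
      · simp [A, Matrix.mulVec, dotProduct, Fin.sum_univ_succ]
    have hM : pathMatrix x q (l + 1) -
        Matrix.vecMulVec (c • pathVec q (l + 1)) (pathVec q (l + 1)) =
        A - Matrix.vecMulVec (e • (Fin.cons 1 (pathVec q l) : Fin (l + 1) → K))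
          (Fin.cons 1 (pathVec q l)) := by
      ext j k
      refine Fin.cases ?_ (fun j => ?_) j <;> refine Fin.cases ?_ (fun k => ?_) k
      · simp [A, pathMatrix, pathVec, Matrix.vecMulVec_apply, he]
        ring
      · simp [A, pathMatrix, pathVec, Matrix.vecMulVec_apply, he, (Fin.succ_ne_zero _).symm]
        ring
      · simp [A, pathMatrix, pathVec, Matrix.vecMulVec_apply, he, Fin.succ_ne_zero]
        ring
      · simp [A, pathMatrix, pathVec, Matrix.vecMulVec_apply, he]
        ring
    rw [hM, Matrix.det_sub_vecMulVec_of_mulVec_eq hAy, hA]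
    have hdot : (Fin.cons 1 (pathVec q l) : Fin (l + 1) → K) ⬝ᵥ
        (e • (Fin.cons x⁻¹ y : Fin (l + 1) → K)) = e * (x⁻¹ + pathVec q l ⬝ᵥ y) := by
      rw [dotProduct_smul]
      simp [dotProduct, Fin.sum_univ_succ]
    rw [hdot, pathSeq]
    field_simp
    linear_combination (-e * x) * hwy

theorem det_pathMatrix {K : Type*} [Field K] {x q : K} (hx : x ≠ 0)
    (hβ : ∀ l, (pathSeq x q l).1 ≠ 0) (l : ℕ) :
    (pathMatrix x q l).det = (pathSeq x q l).1 := by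
  simpa using det_pathMatrix_sub hx hβ l 0

open Matrix in
theorem exists_pathMatrix_mulVec_eq {K : Type*} [Field K] {x q : K} (hx : x ≠ 0)
    (hβ : ∀ l, (pathSeq x q l).1 ≠ 0) (l : ℕ) :
    ∃ y, pathMatrix x q l *ᵥ y = pathVec q l ∧
      pathVec q l ⬝ᵥ y = (pathSeq x q l).2 / (pathSeq x q l).1 :=
  Matrix.exists_mulVec_eq_of_det_sub_vecMulVec (hβ l) (det_pathMatrix hx hβ l)
    (by simpa using det_pathMatrix_sub hx hβ l 1)

/-! ### Reduction to the core graph -/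

/-- With `W` the matrix of the powers of `q` to the distances between a vertex `u` and its root and
`D` the exponential distance matrix of `C`, the matrix `x I - D_q` of `attachPaths C r l` is
`A - W D Wᵀ` for a block diagonal `A`. The determinant is then computed in size `V × V`. -/
theorem det_sub_expDistMatrix_attachPaths {K V ι : Type*} [Field K] [Fintype V] [DecidableEq V]
    [Fintype ι] [LinearOrder ι] {x q : K} (hx : x ≠ 0) (hβ : ∀ l, (pathSeq x q l).1 ≠ 0)
    {C : SimpleGraph V} (hC : C.Connected) (r : ι → V) (l : ι → ℕ) :
    (x • 1 - expDistMatrix q (attachPaths C r l)).det =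
      x ^ Fintype.card V * (∏ i, (pathSeq x q (l i)).1) *
        (1 - Matrix.diagonal (fun v => x⁻¹ + ∑ i, if r i = v then
          (pathSeq x q (l i)).2 / (pathSeq x q (l i)).1 else 0) * expDistMatrix q C).det := by
  choose y hy hwy using exists_pathMatrix_mulVec_eq hx hβ
  let A : Matrix (V ⊕ (Σ i : ι, Fin (l i))) (V ⊕ (Σ i : ι, Fin (l i))) K :=
    Matrix.fromBlocks (x • 1) 0 0 (Matrix.blockDiagonal' fun i => pathMatrix x q (l i))
  let W : Matrix (V ⊕ (Σ i : ι, Fin (l i))) V K := Matrix.fromRows 1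
    (Matrix.of fun p v => if r p.1 = v then pathVec q (l p.1) p.2 else 0)
  let Z : Matrix (V ⊕ (Σ i : ι, Fin (l i))) V K := Matrix.fromRows (x⁻¹ • 1)
    (Matrix.of fun p v => if r p.1 = v then y (l p.1) p.2 else 0)
  have hA : A.det = x ^ Fintype.card V * ∏ i, (pathSeq x q (l i)).1 := by
    simp [A, Matrix.det_blockDiagonal', det_pathMatrix hx hβ]
  have hAZ : A * Z = W := by
    ext (u | ⟨i, a⟩) v
    · simp [A, Z, W, Matrix.fromBlocks_mul_fromRows, hx]
    · have := congrFun (hy (l i)) a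
      simp only [Matrix.mulVec, dotProduct] at this
      simp [A, Z, W, Matrix.mul_apply, Fintype.sum_sigma, Matrix.blockDiagonal'_apply]
      rw [Finset.sum_eq_single i (fun j _ hj => by simp [hj.symm]) (by simp)]
      simp [this]
  -- Distinct columns of `W` and `Z` have disjoint supports, as every vertex has only one root.
  have hWZ : W.transpose * Z = Matrix.diagonal (fun v => x⁻¹ + ∑ i, if r i = v then
      (pathSeq x q (l i)).2 / (pathSeq x q (l i)).1 else 0) := by
    ext u v
    simp [W, Z, Matrix.mul_apply, Fintype.sum_sigma, Matrix.diagonal_apply, Matrix.one_apply]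
    by_cases huv : u = v
    · subst huv
      simp only [if_true, add_right_inj]
      refine Finset.sum_congr rfl fun i _ => ?_
      split_ifs
      · exact hwy (l i)
      · rfl
    · simp only [huv, Ne.symm huv, if_false, zero_add]
      refine Finset.sum_eq_zero fun i _ => ?_
      split_ifs with h1 h2
      · exact absurd (h2.symm.trans h1) huv
      · rfl
      · rfl
  have hM : x • 1 - expDistMatrix q (attachPaths C r l) =
      A - W * (expDistMatrix q C * W.transpose) := by
    ext (u | ⟨i, a⟩) (v | ⟨j, b⟩)
    · simp [A, W, expDistMatrix_attachPaths q hC, attachPathsDist, Matrix.mul_apply,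
        expDistMatrix_of_connected q hC, Matrix.one_apply]
    · simp [A, W, expDistMatrix_attachPaths q hC, attachPathsDist, Matrix.mul_apply,
        expDistMatrix_of_connected q hC, pathVec, pow_add]
    · simp [A, W, expDistMatrix_attachPaths q hC, attachPathsDist, Matrix.mul_apply,
        expDistMatrix_of_connected q hC, Matrix.one_apply, pathVec, pow_add]
    · by_cases hij : i = j
      · subst hij
        simp [A, W, expDistMatrix_attachPaths q hC, attachPathsDist, Matrix.mul_apply,
          expDistMatrix_of_connected q hC, Matrix.one_apply, pathVec, pathMatrix,
          Matrix.blockDiagonal'_apply]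
        ring
      · simp [A, W, expDistMatrix_attachPaths q hC, attachPathsDist, Matrix.mul_apply,
          expDistMatrix_of_connected q hC, pathVec, pow_add,
          Matrix.blockDiagonal'_apply, hij]
        ring
  rw [hM, ← Matrix.mul_assoc,
    Matrix.det_sub_mul_of_mul_eq (Y := Z * expDistMatrix q C) (by rw [← Matrix.mul_assoc, hAZ]), hA,
    ← Matrix.mul_assoc, hWZ]

/-! ### The two families over a field -/

/-- The coefficients are the principal minors of `D_q` of the 4-cycle, up to sign. -/
theorem det_one_sub_diagonal_mul {R : Type*} [CommRing R] (q : R) (g : Fin 4 → R) :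
    (1 - Matrix.diagonal g * expDistMatrix q (SimpleGraph.cycleGraph 4)).det =
    1 - (g 0 + g 1 + g 2 + g 3)
      + (1 - q ^ 2) * (g 0 * g 1 + g 1 * g 2 + g 2 * g 3 + g 3 * g 0)
      + (1 - q ^ 4) * (g 0 * g 2 + g 1 * g 3)
      - (1 - q ^ 2) ^ 2 * (g 0 * g 1 * g 2 + g 1 * g 2 * g 3 + g 2 * g 3 * g 0 + g 3 * g 0 * g 1)
      + (1 - q ^ 2) ^ 4 * (g 0 * g 1 * g 2 * g 3) := by
  have h : 1 - Matrix.diagonal g *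
      !![1, q, q ^ 2, q; q, 1, q, q ^ 2; q ^ 2, q, 1, q; q, q ^ 2, q, 1] =
      !![1 - g 0, -(g 0 * q), -(g 0 * q ^ 2), -(g 0 * q);
        -(g 1 * q), 1 - g 1, -(g 1 * q), -(g 1 * q ^ 2);
        -(g 2 * q ^ 2), -(g 2 * q), 1 - g 2, -(g 2 * q);
        -(g 3 * q), -(g 3 * q ^ 2), -(g 3 * q), 1 - g 3] := by
    ext i j
    fin_cases i <;> fin_cases j <;> simp [Matrix.diagonal_mul]
  rw [expDistMatrix_cycleGraph_four, h]
  simp [Matrix.det_succ_row_zero, Fin.sum_univ_succ, Fin.succAbove]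
  ring

/-- Both sides are expressed through `β` and `τ` at `k + 1`. The result is a polynomial identity in
`x`, `q` and these two values, which does not use how they depend on `k`. -/
theorem family_det_identity {K : Type*} [Field K] {x q : K} (hx : x ≠ 0)
    (hβ : ∀ l, (pathSeq x q l).1 ≠ 0) (k : ℕ) :
    (∏ i, (pathSeq x q (![1, k + 3, k + 2, k + 1] i)).1) *
        (1 - Matrix.diagonal (fun v => x⁻¹ + ∑ i, if (![0, 1, 1, 2] : Fin 4 → Fin 4) i = v then
          (pathSeq x q (![1, k + 3, k + 2, k + 1] i)).2 /
            (pathSeq x q (![1, k + 3, k + 2, k + 1] i)).1 else 0) *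
            expDistMatrix q (SimpleGraph.cycleGraph 4)).det =
    (∏ i, (pathSeq x q (![2, k + 2, k + 2, k + 1] i)).1) *
        (1 - Matrix.diagonal (fun v => x⁻¹ + ∑ i, if (![0, 0, 1, 2] : Fin 4 → Fin 4) i = v then
          (pathSeq x q (![2, k + 2, k + 2, k + 1] i)).2 /
            (pathSeq x q (![2, k + 2, k + 2, k + 1] i)).1 else 0) *
            expDistMatrix q (SimpleGraph.cycleGraph 4)).det := by
  have h1 := hβ 1
  have h2 := hβ 2
  have hk1 := hβ (k + 1)
  have hk2 := hβ (k + 2)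
  have hk3 := hβ (k + 3)
  rw [det_one_sub_diagonal_mul, det_one_sub_diagonal_mul]
  simp [Fin.sum_univ_succ, Fin.prod_univ_succ]
  have s1 : pathSeq x q 1 = (x - (1 - q ^ 2), q ^ 2) := by simp [pathSeq]
  have s2 : pathSeq x q 2 = ((x - (1 - q ^ 2)) ^ 2 - (1 - q ^ 2) * x * q ^ 2,
      q ^ 2 * (x - (1 - q ^ 2) + x * q ^ 2)) := by
    rw [pathSeq, s1]
    exact Prod.ext (by dsimp only; ring) rfl
  -- `pathSeq x q (k + 1)` stays opaque, so `ring` sees it as two independent variables.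
  have sk2 : pathSeq x q (k + 2) = _ := pathSeq.eq_2 x q (k + 1)
  have sk3 : pathSeq x q (k + 3) = _ := pathSeq.eq_2 x q (k + 2)
  field_simp
  simp only [sk3, sk2, s2, s1]
  ring

/-! ### The generic parameter and specialization -/

theorem map_pathSeq {R S : Type*} [CommRing R] [CommRing S] (f : R →+* S) (x q : R) (l : ℕ) :
    pathSeq (f x) (f q) l = (f (pathSeq x q l).1, f (pathSeq x q l).2) := by
  induction l with
  | zero => simp [pathSeq]
  | succ l ih => simp [pathSeq, ih]

open Polynomial in
/-- Over `ℤ[q][x]` no `β l` vanishes, because `β l = 1` at `q = 0` and `x = 2`. -/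
theorem pathSeq_fst_ne_zero (l : ℕ) : (pathSeq (X : ℤ[X][X]) (C X) l).1 ≠ 0 := by
  intro h
  have key : pathSeq (2 : ℤ) 0 l = (1, 0) := by
    clear h
    induction l with
    | zero => rfl
    | succ l ih => simp [pathSeq, ih]
  have := map_pathSeq (eval₂RingHom (evalRingHom (0 : ℤ)) 2) (X : ℤ[X][X]) (C X) l
  simp [h, key] at this

theorem map_expDistMatrix {R S V : Type*} [CommRing R] [CommRing S] (f : R →+* S) (q : R)
    (G : SimpleGraph V) : (expDistMatrix q G).map f = expDistMatrix (f q) G := by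
  ext u v
  simp only [expDistMatrix, Matrix.map_apply, Matrix.of_apply]
  split_ifs <;> simp

open Polynomial in
/-- The generic case: `q` is the indeterminate of `ℤ[q]`. The determinants are compared in the
fraction field of `ℤ[q][x]`, where no denominator vanishes. -/
theorem dqCospectral_family_X (k : ℕ) : DqCospectral (X : ℤ[X]) (familyG₁ k) (familyG₂ k) := by
  let f := algebraMap ℤ[X][X] (FractionRing ℤ[X][X])
  have hf : Function.Injective f := IsFractionRing.injective _ _
  have hx : f X ≠ 0 := (map_ne_zero_iff f hf).2 X_ne_zero
  have hβ : ∀ l, (pathSeq (f X) (f (C X)) l).1 ≠ 0 := fun l => by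
    rw [map_pathSeq]
    exact (map_ne_zero_iff f hf).2 (pathSeq_fst_ne_zero l)
  have map_charpoly : ∀ {V : Type} [Fintype V] [DecidableEq V] (G : SimpleGraph V),
      f (expDistMatrix (X : ℤ[X]) G).charpoly = (f X • 1 - expDistMatrix (f (C X)) G).det := by
    intro V _ _ G
    rw [Matrix.charpoly, RingHom.map_det]
    congr 1
    rw [← map_expDistMatrix f, ← map_expDistMatrix C]
    ext u v
    by_cases huv : u = v <;> simp [huv]
  apply hf
  rw [map_charpoly, map_charpoly, familyG₁, familyG₂,
    det_sub_expDistMatrix_attachPaths hx hβ connected_cycleGraph_four,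
    det_sub_expDistMatrix_attachPaths hx hβ connected_cycleGraph_four, mul_assoc, mul_assoc,
    family_det_identity hx hβ]

theorem dqCospectral_family {R : Type*} [CommRing R] (q : R) (k : ℕ) :
    DqCospectral q (familyG₁ k) (familyG₂ k) := by
  have h := congrArg (Polynomial.map (Polynomial.eval₂RingHom (Int.castRingHom R) q))
    (dqCospectral_family_X k)
  rw [← Matrix.charpoly_map, ← Matrix.charpoly_map, map_expDistMatrix, map_expDistMatrix] at h
  simpa [DqCospectral] using h

theorem mainTheorem8 (k : ℕ) :
    (∀ (R : Type*) [CommRing R] (q : R), DqCospectral q (familyG₁ k) (familyG₂ k)) ∧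
      ∀ q : ℂ, expDistSpectrum q (familyG₁ k) = expDistSpectrum q (familyG₂ k) :=
  ⟨fun _ _ q => dqCospectral_family q k,
    fun q => congrArg Polynomial.roots (dqCospectral_family q k)⟩
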